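/- A directed hypergraph $G$ consists of a set of vertices and a finite set $E(G)$ of arcs; an arc is an ordered pair $e=(T(e),H(e))$ of disjoint finite sets of vertices, its tail and its head. Let $r,s\ge 1$ be integers and let $G$ be an $(r,s)$-directed hypergraph, i.e. $|T(e)|=r$ and $|H(e)|=s$ for every arc $e$. Put $T(G)=\bigcup_{e}T(e)$ and $H(G)=\bigcup_{e}H(e)$. For real $p,q\ge 1$, the $(p,q)$-spectral radius of $G$ is $$\lambda_{p,q}(G)=\max\Big\{\sum_{e\in E(G)}\prod_{u\in T(e)}x_u\prod_{v\in H(e)}y_v\;:\;x\in\mathbb R^{T(G)},\ y\in\mathbb R^{H(G)},\ \|x\|_p=\|y\|_q=1\Big\}.$$ The bipartite split $\mathcal B(G)$ is the directed hypergraph whose vertex set is the disjoint union of a copy $V_T$ of $T(G)$ and a copy $V_H$ of $H(G)$, and in which each arc $e$ of $G$ becomes the arc from the copy of $T(e)$ in $V_T$ to the copy of $H(e)$ in $V_H$. Let $\overline G$ be its underlying hypergraph: the undirected $(r+s)$-uniform hypergraph on $V_T\,\dot\cup\,V_H$ obtained by replacing each arc by the edge with the same vertices. For a $k$-uniform hypergraph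 $H$ on a finite vertex set $W$, the adjacency tensor is the tensor $a$ of order $k$ indexed by $W$ with $a_{i_1\cdots i_k}=\frac1{(k-1)!}$ if $\{i_1,\dots,i_k\}\in E(H)$ and $0$ otherwise; a complex number $\mu$ is an eigenvalue if there is $0\ne x\in\mathbb C^W$ with $\sum_{i_2,\dots,i_k}a_{i i_2\cdots i_k}x_{i_2}\cdots x_{i_k}=\mu x_i^{k-1}$ for all $i\in W$; and the spectral radius $\rho(H)$ is the largest modulus of an eigenvalue. (If $G$ has no arcs, put $\lambda_{p,q}(G)=\rho(\overline G)=0$.) **Theorem.** Let $p,q\ge 1$ be real numbers with $\frac rp+\frac sq=1$. 1. If $p\le q$, then $\displaystyle \lambda_{p,q}(G)\le\frac{1}{r^{r/p}s^{s/q}}\,\rho(\overline G)^{(r+s)/p}$. 2. If $p>q$, then $\displaystyle \lambda_{p,q}(G)\le\frac{1}{r^{r/p}s^{s/q}}\,\rho(\overline G)^{(r+s)/q}$. 3. If $p=q=r+s$, then $\displaystyle \lambda_{p,q}(G)=\frac{1}{(r^rs^s)^{1/(r+s)}}\,\rho(\overline G)$. -/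

import Mathlib

open Finset

noncomputable section

/-- A directed hypergraph on the vertex type `V` with finitely many arcs: an arc is an ordered
pair `(X, Y)` of disjoint finite sets of vertices, `X` being its tail and `Y` its head. -/
structure DirectedHypergraph (V : Type*) where
  /-- the set of arcs -/
  arcs : Finset (Finset V × Finset V)
  disjoint_of_mem : ∀ e ∈ arcs, Disjoint e.1 e.2

/-- The `p`-norm `(∑ |x_i| ^ p) ^ (1 / p)` of a real vector. -/
def vecNorm {ι : Type*} [Fintype ι] (p : ℝ) (x : ι → ℝ) : ℝ :=
  (∑ i, |x i| ^ p) ^ (1 / p)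

namespace DirectedHypergraph

variable {V : Type*}

/-- Every arc has exactly `r` vertices in its tail and `s` vertices in its head. -/
def IsUniform (G : DirectedHypergraph V) (r s : ℕ) : Prop :=
  ∀ e ∈ G.arcs, e.1.card = r ∧ e.2.card = s

variable [DecidableEq V]

/-- `T(G)`, the union of the tails of all arcs. -/
def tailVerts (G : DirectedHypergraph V) : Finset V := G.arcs.biUnion fun e => e.1

/-- `H(G)`, the union of the heads of all arcs. -/
def headVerts (G : DirectedHypergraph V) : Finset V := G.arcs.biUnion fun e => e.2

/-- The polynomial form `P_G(x, y) = ∑ e, (∏ u ∈ T(e), x u) * (∏ v ∈ H(e), y v)`, for vectors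
`x` indexed by `T(G)` and `y` indexed by `H(G)`. -/
def polyForm (G : DirectedHypergraph V) (x : G.tailVerts → ℝ) (y : G.headVerts → ℝ) : ℝ :=
  ∑ e ∈ G.arcs, (∏ u ∈ e.1.subtype (· ∈ G.tailVerts), x u) *
    ∏ v ∈ e.2.subtype (· ∈ G.headVerts), y v

/-- The values of `P_G(x, y)` over all `x`, `y` with `‖x‖_p = ‖y‖_q = 1`. -/
def formValues (G : DirectedHypergraph V) (p q : ℝ) : Set ℝ :=
  {t | ∃ (x : G.tailVerts → ℝ) (y : G.headVerts → ℝ),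
    vecNorm p x = 1 ∧ vecNorm q y = 1 ∧ t = G.polyForm x y}

/-- The `(p, q)`-spectral radius, the maximum of `P_G(x, y)` over `‖x‖_p = ‖y‖_q = 1`
(it is attained if there are arcs, see `isGreatest_lambda`; it is `0` if there are none). -/
def lambda (G : DirectedHypergraph V) (p q : ℝ) : ℝ := sSup (G.formValues p q)

/-- The bipartite split: its vertex set is the disjoint union of a copy of `T(G)` and a copy of
`H(G)`; each arc `e` of `G` becomes the arc from the copy of `T(e)` to the copy of `H(e)`. -/
def bipartiteSplit (G : DirectedHypergraph V) :
    DirectedHypergraph (G.tailVerts ⊕ G.headVerts) where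
  arcs := G.arcs.image fun e =>
    ((e.1.subtype (· ∈ G.tailVerts)).map Function.Embedding.inl,
      (e.2.subtype (· ∈ G.headVerts)).map Function.Embedding.inr)
  disjoint_of_mem := by
    intro e he
    obtain ⟨f, -, rfl⟩ := Finset.mem_image.1 he
    rw [Finset.disjoint_left]
    intro a ha hb
    simp only [Finset.mem_map] at ha hb
    obtain ⟨u, -, rfl⟩ := ha
    obtain ⟨v, -, h⟩ := hb
    simp at h

/-- The underlying hypergraph: same vertices, each arc is replaced by the edge with the same
vertices. -/
def underlying (G : DirectedHypergraph V) : Hypergraph V where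
  vertexSet := Set.univ
  edgeSet := {f | ∃ e ∈ G.arcs, f = (↑(e.1 ∪ e.2) : Set V)}
  subset_vertexSet_of_mem_edgeSet' := fun f _ => Set.subset_univ f

instance [Fintype V] (G : DirectedHypergraph V) : Fintype G.underlying.vertexSet :=
  inferInstanceAs (Fintype (Set.univ : Set V))

end DirectedHypergraph

/-- `μ` is an eigenvalue of the real tensor `a` of order `d + 1`: for some nonzero complex vector
`x`, `∑_{i_2, …, i_{d+1}} a_{i i_2 … i_{d+1}} x_{i_2} ⋯ x_{i_{d+1}} = μ * x_i ^ d` for all `i`. -/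
def IsTensorEigenvalue {W : Type*} [Fintype W] {d : ℕ} (a : (Fin (d + 1) → W) → ℝ) (μ : ℂ) :
    Prop :=
  ∃ x : W → ℂ, x ≠ 0 ∧
    ∀ i, ∑ j : Fin d → W, (a (Fin.cons i j) : ℂ) * ∏ l, x (j l) = μ * x i ^ d

/-- The spectral radius of a tensor, the largest modulus of an eigenvalue. -/
def tensorSpectralRadius {W : Type*} [Fintype W] {d : ℕ} (a : (Fin (d + 1) → W) → ℝ) : ℝ :=
  sSup {t | ∃ μ : ℂ, IsTensorEigenvalue a μ ∧ t = ‖μ‖}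

open Classical in
/-- The adjacency tensor of a `k`-uniform hypergraph (`1 ≤ k`), of order `k = (k - 1) + 1` and
indexed by the vertices: its `(i_1, …, i_k)`-entry is `1 / (k - 1)!` if `{i_1, …, i_k}` is an edge,
and `0` otherwise. -/
def Hypergraph.adjacencyTensor {W : Type*} (H : Hypergraph W) (k : ℕ) :
    (Fin (k - 1 + 1) → H.vertexSet) → ℝ :=
  fun i => if Set.range (fun l => (i l : W)) ∈ H.edgeSet then 1 / ((k - 1).factorial : ℝ) else 0

/-- The spectral radius of a `k`-uniform hypergraph (`1 ≤ k`), i.e. that of its adjacency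
tensor. -/
def Hypergraph.spectralRadius {W : Type*} (H : Hypergraph W) [Fintype H.vertexSet] (k : ℕ) : ℝ :=
  tensorSpectralRadius (H.adjacencyTensor k)

/-- The unit sphere of the `p`-norm is compact. -/
theorem isCompact_vecNorm_eq_one {ι : Type*} [Fintype ι] {p : ℝ} (hp : 1 ≤ p) :
    IsCompact {x : ι → ℝ | vecNorm p x = 1} := by
  have hp0 : 0 < p := by linarith
  have key : ∀ x : ι → ℝ, vecNorm p x = 1 → ∀ i, |x i| ≤ 1 := by
    intro x hx i
    have hS : ∑ i, |x i| ^ p = 1 := by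
      have h0 : 0 ≤ ∑ i, |x i| ^ p := by positivity
      have := congrArg (· ^ p) hx
      simpa [vecNorm, ← Real.rpow_mul h0, inv_mul_cancel₀ hp0.ne'] using this
    have h1 : |x i| ^ p ≤ 1 := by
      rw [← hS]
      exact Finset.single_le_sum (f := fun i => |x i| ^ p) (fun j _ => by positivity)
        (Finset.mem_univ i)
    by_contra h
    push Not at h
    exact absurd h1 (not_le.2 (Real.one_lt_rpow h hp0))
  refine Metric.isCompact_of_isClosed_isBounded ?_ ?_
  · have : Continuous (fun x : ι → ℝ => vecNorm p x) := by
      unfold vecNorm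
      refine Continuous.rpow_const ?_ (fun _ => Or.inr (by positivity))
      refine continuous_finsetSum _ fun i _ => ?_
      exact ((continuous_apply i).abs).rpow_const fun _ => Or.inr hp0.le
    exact isClosed_eq this continuous_const
  · rw [isBounded_iff_forall_norm_le]
    exact ⟨1, fun x hx => (pi_norm_le_iff_of_nonneg zero_le_one).2 fun i => key x hx i⟩

/-- The unit sphere of the `p`-norm is nonempty in positive dimension. -/
theorem exists_vecNorm_eq_one {ι : Type*} [Fintype ι] [Nonempty ι] {p : ℝ} (hp : 1 ≤ p) :
    ∃ x : ι → ℝ, vecNorm p x = 1 := by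
  classical
  have hp0 : p ≠ 0 := by linarith
  refine ⟨Pi.single (Classical.arbitrary ι) 1, ?_⟩
  unfold vecNorm
  rw [Finset.sum_eq_single (Classical.arbitrary ι)] <;>
    simp +contextual [Real.zero_rpow hp0]

/-- The maximum in the definition of the `(p, q)`-spectral radius is attained. -/
theorem DirectedHypergraph.isGreatest_lambda {V : Type*} [DecidableEq V]
    (G : DirectedHypergraph V) {r s : ℕ} (hr : 1 ≤ r) (hs : 1 ≤ s) (hG : G.IsUniform r s)
    (hne : G.arcs.Nonempty) {p q : ℝ} (hp : 1 ≤ p) (hq : 1 ≤ q) :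
    IsGreatest (G.formValues p q) (G.lambda p q) := by
  obtain ⟨e, he⟩ := hne
  have hT : Nonempty G.tailVerts := by
    obtain ⟨u, hu⟩ := Finset.card_pos.1 (show 0 < e.1.card by rw [(hG e he).1]; omega)
    exact ⟨u, Finset.mem_biUnion.2 ⟨e, he, hu⟩⟩
  have hH : Nonempty G.headVerts := by
    obtain ⟨u, hu⟩ := Finset.card_pos.1 (show 0 < e.2.card by rw [(hG e he).2]; omega)
    exact ⟨u, Finset.mem_biUnion.2 ⟨e, he, hu⟩⟩
  obtain ⟨x₀, hx₀⟩ := exists_vecNorm_eq_one (ι := G.tailVerts) hp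
  obtain ⟨y₀, hy₀⟩ := exists_vecNorm_eq_one (ι := G.headVerts) hq
  have hc : Continuous fun z : (G.tailVerts → ℝ) × (G.headVerts → ℝ) => G.polyForm z.1 z.2 := by
    unfold DirectedHypergraph.polyForm
    fun_prop
  have hK := ((isCompact_vecNorm_eq_one (ι := G.tailVerts) hp).prod
    (isCompact_vecNorm_eq_one (ι := G.headVerts) hq)).image hc
  have hEq : G.formValues p q = (fun z : (G.tailVerts → ℝ) × (G.headVerts → ℝ) =>
      G.polyForm z.1 z.2) '' ({x | vecNorm p x = 1} ×ˢ {y | vecNorm q y = 1}) := by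
    ext t
    constructor
    · rintro ⟨x, y, hx, hy, rfl⟩
      exact ⟨(x, y), ⟨hx, hy⟩, rfl⟩
    · rintro ⟨⟨x, y⟩, ⟨hx, hy⟩, rfl⟩
      exact ⟨x, y, hx, hy, rfl⟩
  unfold DirectedHypergraph.lambda
  rw [hEq]
  exact hK.isGreatest_sSup ⟨_, (x₀, y₀), ⟨hx₀, hy₀⟩, rfl⟩

/-- The moduli of the eigenvalues of a tensor are bounded. -/
theorem bddAbove_norm_tensorEigenvalue {W : Type*} [Fintype W] {d : ℕ}
    (a : (Fin (d + 1) → W) → ℝ) :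
    BddAbove {t | ∃ μ : ℂ, IsTensorEigenvalue a μ ∧ t = ‖μ‖} := by
  refine ⟨∑ i, ∑ j : Fin d → W, |a (Fin.cons i j)|, ?_⟩
  rintro t ⟨μ, ⟨x, hx, h⟩, rfl⟩
  obtain ⟨w, hw⟩ := Function.ne_iff.1 hx
  obtain ⟨i, -, hi⟩ := Finset.exists_max_image Finset.univ (fun i => ‖x i‖) ⟨w, Finset.mem_univ w⟩
  have hpos : 0 < ‖x i‖ := lt_of_lt_of_le (norm_pos_iff.2 hw) (hi w (Finset.mem_univ w))
  have h1 : ‖μ‖ * ‖x i‖ ^ d ≤ (∑ j : Fin d → W, |a (Fin.cons i j)|) * ‖x i‖ ^ d := by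
    rw [← norm_pow, ← norm_mul, ← h i, Finset.sum_mul]
    refine (norm_sum_le _ _).trans (Finset.sum_le_sum fun j _ => ?_)
    rw [norm_mul, Complex.norm_real, Real.norm_eq_abs, norm_prod, norm_pow]
    gcongr
    calc ∏ l, ‖x (j l)‖ ≤ ∏ _l : Fin d, ‖x i‖ :=
          Finset.prod_le_prod (fun _ _ => norm_nonneg _) fun l _ => hi _ (Finset.mem_univ _)
      _ = ‖x i‖ ^ d := by simp
  refine (le_of_mul_le_mul_right h1 (pow_pos hpos d)).trans ?_
  exact Finset.single_le_sum (f := fun i => ∑ j : Fin d → W, |a (Fin.cons i j)|)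
    (fun _ _ => Finset.sum_nonneg fun _ _ => abs_nonneg _) (Finset.mem_univ i)

end

/-! Put k = r + s and let ρ be the spectral radius of the underlying hypergraph of the split. Its
edge polynomial is the form P(z, w) = ∑ z^{T(e)} w^{H(e)}, with independent variables for tails and
heads. The number ρ is the least C ≥ 0 with k P(z, w) ≤ C (‖z‖_k^k + ‖w‖_k^k) for all nonnegative z,
w: a maximiser on the unit sphere yields an eigenvalue (`IsEdgeTensor.mul_edgePoly_le`), and Euler's
identity bounds every eigenvalue by C (`IsEdgeTensor.spectralRadius_le`). Scaling z and w separately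
gives r^{r/k} s^{s/k} P(z, w) ≤ ρ ‖z‖_k^r ‖w‖_k^s.

Let p ≤ q (`pairForm_le_rpow`), θ = p/q, so that r + sθ = p. Let S = P(x, y), let π(e) be the term
of the arc e, and D_v the sum of π(e) over the heads containing v. The test vectors z = x^{p/k} and
w = y^{p/k} D^{(1-θ)/k} satisfy ‖z‖_k = 1, ‖w‖_k^k ≤ (sS)^{1-θ} by Hölder, and P(z, w) ≥ S because
D_v ≥ π(e) for v ∈ H(e). Solving for S gives the bound. Exchanging tails and heads settles p > q.
For p = q = k, weighted AM-GM turns λ, up to its constant, into an admissible C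
(`mul_pairForm_le_of_unit`), which is the reverse inequality. -/

noncomputable section

/-! ### Edge polynomials and adjacency tensors -/

/-- The edge polynomial `∑ e, ∏ v ∈ e, x v` of a finite family of finite sets. -/
def edgePoly {W R : Type*} [CommSemiring R] (F : Finset (Finset W)) (x : W → R) : R :=
  ∑ e ∈ F, ∏ v ∈ e, x v

/-- The partial derivative of the edge polynomial with respect to the variable `x i`. -/
def edgePolyPartial {W R : Type*} [DecidableEq W] [CommSemiring R] (F : Finset (Finset W))
    (i : W) (x : W → R) : R :=
  ∑ e ∈ F with i ∈ e, ∏ v ∈ e.erase i, x v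

theorem vecNorm_eq_one_iff {ι : Type*} [Fintype ι] {p : ℝ} (hp : 0 < p) {x : ι → ℝ} :
    vecNorm p x = 1 ↔ ∑ i, |x i| ^ p = 1 := by
  have h := Real.rpow_left_inj (x := ∑ i, |x i| ^ p) (by positivity) zero_le_one
    (one_div_pos.2 hp).ne'
  rwa [Real.one_rpow] at h

theorem eq_zero_of_sum_pow_eq_zero {ι : Type*} [Fintype ι] {k : ℕ} {f : ι → ℝ}
    (hf : ∀ i, 0 ≤ f i) (h : ∑ i, f i ^ k = 0) (i : ι) : f i = 0 :=
  eq_zero_of_pow_eq_zero ((Finset.sum_eq_zero_iff_of_nonneg fun i _ => pow_nonneg (hf i) k).1 h i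
    (mem_univ i))

theorem edgePoly_smul {W : Type*} {F : Finset (Finset W)} {k : ℕ} (hF : ∀ e ∈ F, e.card = k) (c : ℝ)
    (x : W → ℝ) : edgePoly F (fun v => c * x v) = c ^ k * edgePoly F x := by
  unfold edgePoly
  rw [Finset.mul_sum]
  refine Finset.sum_congr rfl fun e he => ?_
  rw [Finset.prod_mul_distrib, Finset.prod_const, hF e he]

section EdgePoly

variable {W : Type*} [DecidableEq W]

/-- By cardinality such tuples are exactly the enumerations of `S`; the count cancels the
normalization 1/d! of the tensor. -/
theorem card_filter_image_eq [Fintype W] {d : ℕ} {S : Finset W} (hS : S.card = d) :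
    (univ.filter fun j : Fin d → W => univ.image j = S).card = d.factorial := by
  have h1 : Fintype.card (Fin d ↪ S) = d.factorial := by
    rw [Fintype.card_embedding_eq]
    simp [hS, Nat.descFactorial_self]
  rw [← h1, ← Finset.card_univ]
  symm
  refine Finset.card_bij (fun f _ l => (f l : W)) ?_ ?_ ?_
  · intro f _
    simp only [mem_filter, mem_univ, true_and]
    refine Finset.eq_of_subset_of_card_le ?_ ?_
    · intro v hv
      obtain ⟨l, -, rfl⟩ := mem_image.1 hv
      exact (f l).2
    · have hinj : Function.Injective fun l => (f l : W) :=
        Subtype.val_injective.comp f.injective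
      rw [Finset.card_image_of_injective _ hinj]
      simp [hS]
  · intro f _ g _ h
    ext l
    exact congrFun h l
  · intro j hj
    simp only [mem_filter, mem_univ, true_and] at hj
    have hinj : Function.Injective j := by
      rw [← Set.injOn_univ, ← Finset.coe_univ, ← Finset.card_image_iff, hj, hS]
      simp
    exact ⟨⟨fun l => ⟨j l, hj ▸ mem_image_of_mem j (mem_univ l)⟩,
      fun a b h => hinj (congrArg Subtype.val h)⟩, mem_univ _, rfl⟩

theorem sum_prod_filter_image_eq [Fintype W] {R : Type*} [CommSemiring R] {d : ℕ} {S : Finset W}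
    (hS : S.card = d) (x : W → R) :
    ∑ j : Fin d → W with univ.image j = S, ∏ l, x (j l) = d.factorial * ∏ v ∈ S, x v := by
  rw [Finset.sum_congr rfl (g := fun _ => ∏ v ∈ S, x v), Finset.sum_const,
    card_filter_image_eq hS, nsmul_eq_mul]
  intro j hj
  simp only [mem_filter, mem_univ, true_and] at hj
  have hinj : Set.InjOn j (univ : Finset (Fin d)) := by
    rw [← Finset.card_image_iff, hj, hS]
    simp
  rw [← hj, Finset.prod_image hinj]

/-- If `i` occurred among the entries of `j`, the union would have at most `d` elements. -/
theorem insert_image_eq_iff {d : ℕ} {e : Finset W} (he : e.card = d + 1) (i : W)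
    (j : Fin d → W) : insert i (univ.image j) = e ↔ i ∈ e ∧ univ.image j = e.erase i := by
  constructor
  · rintro rfl
    refine ⟨mem_insert_self _ _, ?_⟩
    have : i ∉ univ.image j := by
      intro h
      rw [insert_eq_of_mem h] at he
      have := Finset.card_image_le (s := univ) (f := j)
      simp at this
      omega
    rw [erase_insert this]
  · rintro ⟨hi, h⟩
    rw [h, insert_erase hi]

/-- Euler's identity for homogeneous polynomials: each edge is counted once for each of its
vertices. -/
theorem sum_mul_edgePolyPartial [Fintype W] {R : Type*} [CommSemiring R]
    {F : Finset (Finset W)} {k : ℕ} (hF : ∀ e ∈ F, e.card = k) (x : W → R) :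
    ∑ i, x i * edgePolyPartial F i x = k * edgePoly F x := by
  unfold edgePolyPartial edgePoly
  simp_rw [Finset.sum_filter, Finset.mul_sum]
  rw [Finset.sum_comm]
  refine Finset.sum_congr rfl fun e he => ?_
  simp_rw [mul_ite, mul_zero]
  rw [← Finset.sum_filter, Finset.filter_mem_eq_inter, univ_inter,
    Finset.sum_congr rfl (fun i hi => mul_prod_erase e x hi), Finset.sum_const, hF e he,
    nsmul_eq_mul]

/-- The polynomial is affine in each variable, so the first-order expansion is exact. -/
theorem edgePoly_update (F : Finset (Finset W)) (x : W → ℝ) (i : W) (c : ℝ) :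
    edgePoly F (Function.update x i c) = edgePoly F x + (c - x i) * edgePolyPartial F i x := by
  unfold edgePolyPartial edgePoly
  rw [Finset.sum_filter, Finset.mul_sum, ← Finset.sum_add_distrib]
  refine Finset.sum_congr rfl fun e _ => ?_
  split_ifs with hi
  · rw [Finset.prod_update_of_mem hi, ← mul_prod_erase e x hi, sdiff_singleton_eq_erase]
    ring
  · rw [Finset.prod_update_of_notMem hi]
    ring

/-- A tensor with entry `1 / d!` at the enumerations of the members of `F`. -/
def IsEdgeTensor [Fintype W] {d : ℕ} (a : (Fin (d + 1) → W) → ℝ) (F : Finset (Finset W)) : Prop :=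
  ∀ i, a i = if univ.image i ∈ F then 1 / (d.factorial : ℝ) else 0

/-- Grouping the tuples by the edge they form with `i`, each edge through `i` arises d! times. The
eigenvalue equation thus says that the partial derivative at `i` equals μ x_i^d. -/
theorem IsEdgeTensor.sum_eq [Fintype W] {d : ℕ} {a : (Fin (d + 1) → W) → ℝ}
    {F : Finset (Finset W)} (ha : IsEdgeTensor a F) (hF : ∀ e ∈ F, e.card = d + 1)
    (x : W → ℂ) (i : W) :
    ∑ j : Fin d → W, (a (Fin.cons i j) : ℂ) * ∏ l, x (j l) = edgePolyPartial F i x := by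
  have himg : ∀ j : Fin d → W,
      univ.image (Fin.cons i j : Fin (d + 1) → W) = insert i (univ.image j) := by
    intro j
    ext v
    simp [Fin.exists_fin_succ, eq_comm]
  have h1 : ∀ j : Fin d → W, (a (Fin.cons i j) : ℂ) * ∏ l, x (j l) =
      ∑ e ∈ F, if insert i (univ.image j) = e then 1 / (d.factorial : ℂ) * ∏ l, x (j l) else 0 := by
    intro j
    rw [ha, himg, Finset.sum_ite_eq]
    split_ifs <;> simp
  simp_rw [h1]
  rw [Finset.sum_comm, edgePolyPartial, Finset.sum_filter]
  refine Finset.sum_congr rfl fun e he => ?_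
  simp_rw [insert_image_eq_iff (hF e he)]
  split_ifs with hi
  · simp only [hi, true_and]
    rw [← Finset.sum_filter, ← Finset.mul_sum, sum_prod_filter_image_eq, ← mul_assoc,
      one_div_mul_cancel, one_mul]
    · exact_mod_cast d.factorial_ne_zero
    · rw [card_erase_of_mem hi, hF e he]
      rfl
  · simp [hi]

/-! ### Variational characterization of the spectral radius -/

theorem norm_edgePolyPartial_le (F : Finset (Finset W)) (x : W → ℂ) (i : W) :
    ‖edgePolyPartial F i x‖ ≤ edgePolyPartial F i fun v => ‖x v‖ := by
  unfold edgePolyPartial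
  refine (norm_sum_le _ _).trans (Finset.sum_le_sum fun e _ => ?_)
  rw [norm_prod]

theorem edgePolyPartial_nonneg (F : Finset (Finset W)) {x : W → ℝ} (hx : ∀ v, 0 ≤ x v) (i : W) :
    0 ≤ edgePolyPartial F i x :=
  Finset.sum_nonneg fun _ _ => Finset.prod_nonneg fun v _ => hx v

/-- An upper bound for the spectral radius of a uniform hypergraph. -/
theorem IsEdgeTensor.spectralRadius_le [Fintype W] {d : ℕ} {a : (Fin (d + 1) → W) → ℝ}
    {F : Finset (Finset W)} (ha : IsEdgeTensor a F) (hF : ∀ e ∈ F, e.card = d + 1) {C : ℝ}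
    (hC : 0 ≤ C) (h : ∀ z : W → ℝ, (∀ v, 0 ≤ z v) →
      ((d + 1 : ℕ) : ℝ) * edgePoly F z ≤ C * ∑ v, z v ^ (d + 1)) :
    tensorSpectralRadius a ≤ C := by
  -- `hC` covers the case without eigenvalues, where the supremum is 0 by convention.
  refine Real.sSup_le ?_ hC
  rintro t ⟨μ, ⟨x, hx, hμ⟩, rfl⟩
  have hpos : 0 < ∑ v, ‖x v‖ ^ (d + 1) := by
    obtain ⟨w, hw⟩ := Function.ne_iff.1 hx
    exact Finset.sum_pos' (fun _ _ => by positivity)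
      ⟨w, mem_univ w, pow_pos (norm_pos_iff.2 hw) _⟩
  -- Take moduli in the eigenvalue equation, multiply by |x_i| and sum over i; Euler's identity
  -- turns the right side into k P(|x|).
  refine le_of_mul_le_mul_right ?_ hpos
  refine le_trans ?_ (h (fun v => ‖x v‖) fun v => norm_nonneg _)
  rw [← sum_mul_edgePolyPartial hF, Finset.mul_sum]
  refine Finset.sum_le_sum fun i _ => ?_
  have h2 : ‖μ‖ * ‖x i‖ ^ d ≤ edgePolyPartial F i fun v => ‖x v‖ := by
    rw [← norm_pow, ← norm_mul, ← hμ i, ha.sum_eq hF]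
    exact norm_edgePolyPartial_le F x i
  calc ‖μ‖ * ‖x i‖ ^ (d + 1) = ‖x i‖ * (‖μ‖ * ‖x i‖ ^ d) := by ring
    _ ≤ _ := mul_le_mul_of_nonneg_left h2 (norm_nonneg _)

/-- First-order condition at a minimum of `c ↦ L * c ^ (d + 1) - (d + 1) * b * c` on `[0, ∞)`. -/
theorem eq_mul_pow_of_forall_le {d : ℕ} (hd : 1 ≤ d) {L b t : ℝ} (hb : 0 ≤ b) (ht : 0 ≤ t)
    (h : ∀ c, 0 ≤ c → ((d + 1 : ℕ) : ℝ) * ((c - t) * b) ≤ L * (c ^ (d + 1) - t ^ (d + 1))) :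
    b = L * t ^ d := by
  have hk : (0 : ℝ) < ((d + 1 : ℕ) : ℝ) := by positivity
  -- At the endpoint t = 0 only one-sided variation is possible: dividing by c and letting c → 0⁺
  -- forces b = 0.
  rcases ht.eq_or_lt with rfl | ht
  · have hlim : Filter.Tendsto (fun c : ℝ => L * c ^ d) (nhdsWithin 0 (Set.Ioi 0))
        (nhds (L * 0 ^ d)) := by
      refine Filter.Tendsto.mono_left ?_ nhdsWithin_le_nhds
      exact (by fun_prop : Continuous fun c : ℝ => L * c ^ d).tendsto 0
    have h0 : ((d + 1 : ℕ) : ℝ) * b ≤ L * 0 ^ d := by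
      refine ge_of_tendsto hlim ?_
      filter_upwards [self_mem_nhdsWithin] with c hc
      have hc : 0 < c := hc
      have := h c hc.le
      refine le_of_mul_le_mul_right ?_ hc
      rw [zero_pow (by omega)] at this
      calc ((d + 1 : ℕ) : ℝ) * b * c = ((d + 1 : ℕ) : ℝ) * ((c - 0) * b) := by ring
        _ ≤ _ := this
        _ = _ := by ring
    rw [zero_pow (by omega), mul_zero] at h0 ⊢
    nlinarith
  · have hmin : IsLocalMin (fun c : ℝ => L * c ^ (d + 1) - ((d + 1 : ℕ) : ℝ) * (c * b)) t := by
      filter_upwards [lt_mem_nhds ht] with c hc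
      have := h c hc.le
      linarith
    have hder : HasDerivAt (fun c : ℝ => L * c ^ (d + 1) - ((d + 1 : ℕ) : ℝ) * (c * b))
        (L * (((d + 1 : ℕ) : ℝ) * t ^ d) - ((d + 1 : ℕ) : ℝ) * (1 * b)) t := by
      have h1 := (hasDerivAt_pow (d + 1) t).const_mul L
      have h2 := ((hasDerivAt_id t).mul_const b).const_mul ((d + 1 : ℕ) : ℝ)
      exact h1.sub h2
    have := hmin.hasDerivAt_eq_zero hder
    refine mul_left_cancel₀ hk.ne' ?_
    linarith

theorem ofReal_edgePolyPartial (F : Finset (Finset W)) (x : W → ℝ) (i : W) :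
    ((edgePolyPartial F i x : ℝ) : ℂ) = edgePolyPartial F i fun v => (x v : ℂ) := by
  unfold edgePolyPartial
  push_cast
  rfl

/-- A critical point of the edge polynomial yields a real eigenvalue. -/
theorem IsEdgeTensor.isTensorEigenvalue [Fintype W] {d : ℕ} {a : (Fin (d + 1) → W) → ℝ}
    {F : Finset (Finset W)} (ha : IsEdgeTensor a F) (hF : ∀ e ∈ F, e.card = d + 1)
    {x : W → ℝ} (hx : x ≠ 0) {L : ℝ} (h : ∀ i, edgePolyPartial F i x = L * x i ^ d) :
    IsTensorEigenvalue a (L : ℂ) := by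
  refine ⟨fun v => (x v : ℂ), fun h0 => hx ?_, fun i => ?_⟩
  · funext v
    exact Complex.ofReal_eq_zero.1 (congrFun h0 v)
  · have e := ha.sum_eq hF (fun v => (x v : ℂ)) i
    rw [← ofReal_edgePolyPartial, h i, Complex.ofReal_mul, Complex.ofReal_pow] at e
    exact e

/-- The edge polynomial is bounded by the spectral radius. -/
theorem IsEdgeTensor.mul_edgePoly_le [Fintype W] {d : ℕ} (hd : 1 ≤ d)
    {a : (Fin (d + 1) → W) → ℝ} {F : Finset (Finset W)} (ha : IsEdgeTensor a F)
    (hF : ∀ e ∈ F, e.card = d + 1) {z : W → ℝ} (hz : ∀ v, 0 ≤ z v) :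
    ((d + 1 : ℕ) : ℝ) * edgePoly F z ≤ tensorSpectralRadius a * ∑ v, z v ^ (d + 1) := by
  rcases isEmpty_or_nonempty W with hW | hW
  · have : F = ∅ := by
      refine Finset.eq_empty_of_forall_notMem fun e he => ?_
      have := hF e he
      rw [Finset.eq_empty_of_isEmpty e] at this
      simp at this
    simp [this, edgePoly]
  set K : Set (W → ℝ) := {x | ∑ v, |x v| ^ (d + 1) = 1} with hK
  have hKv : K = {x : W → ℝ | vecNorm ((d + 1 : ℕ) : ℝ) x = 1} := by
    ext x
    simp only [hK, Set.mem_ofPred_eq]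
    rw [vecNorm_eq_one_iff (by positivity)]
    simp only [Real.rpow_natCast]
  have hone : (1 : ℝ) ≤ ((d + 1 : ℕ) : ℝ) := by
    push_cast
    linarith [(d.cast_nonneg : (0 : ℝ) ≤ d)]
  have hcomp : IsCompact K := hKv ▸ isCompact_vecNorm_eq_one hone
  have hne : K.Nonempty := hKv ▸ exists_vecNorm_eq_one hone
  have hcont : Continuous fun x : W → ℝ => edgePoly F fun v => |x v| := by
    unfold edgePoly
    fun_prop
  obtain ⟨x₀, hx₀, hmax⟩ := hcomp.exists_isMaxOn hne hcont.continuousOn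
  -- The maximized function and the sphere depend on absolute values only, so the maximiser may be
  -- taken nonnegative.
  set x : W → ℝ := fun v => |x₀ v| with hx
  have hx0 : ∀ v, 0 ≤ x v := fun v => abs_nonneg _
  have hx1 : ∑ v, x v ^ (d + 1) = 1 := hx₀
  set L : ℝ := ((d + 1 : ℕ) : ℝ) * edgePoly F x with hL
  -- Maximality extends from the sphere to all nonnegative vectors by homogeneity.
  have hbound : ∀ y : W → ℝ, (∀ v, 0 ≤ y v) →
      ((d + 1 : ℕ) : ℝ) * edgePoly F y ≤ L * ∑ v, y v ^ (d + 1) := by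
    intro y hy
    have hA0 : 0 ≤ ∑ v, y v ^ (d + 1) := Finset.sum_nonneg fun v _ => pow_nonneg (hy v) _
    set A := ∑ v, y v ^ (d + 1) with hA
    rcases hA0.eq_or_lt with hA0 | hA0
    · have hy0 : ∀ v, y v = 0 := eq_zero_of_sum_pow_eq_zero hy hA0.symm
      have : edgePoly F y = 0 := by
        refine Finset.sum_eq_zero fun e he => ?_
        obtain ⟨v, hv⟩ := Finset.card_pos.1 (by rw [hF e he]; omega : 0 < e.card)
        exact Finset.prod_eq_zero hv (hy0 v)
      rw [this, ← hA0]
      simp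
    · set c : ℝ := A ^ (-(1 : ℝ) / ((d + 1 : ℕ) : ℝ)) with hc
      have hc0 : 0 < c := Real.rpow_pos_of_pos hA0 _
      have hcA : c ^ (d + 1) = A⁻¹ := by
        rw [hc, ← Real.rpow_natCast, ← Real.rpow_mul hA0.le, div_mul_cancel₀ _ (by positivity),
          Real.rpow_neg_one]
      have habs : (fun v => |c * y v|) = fun v => c * y v :=
        funext fun v => abs_of_nonneg (mul_nonneg hc0.le (hy v))
      have hmem : (fun v => c * y v) ∈ K := by
        show ∑ v, |c * y v| ^ (d + 1) = 1
        simp_rw [congrFun habs, mul_pow]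
        rw [← Finset.mul_sum, hcA, ← hA, inv_mul_cancel₀ hA0.ne']
      have := hmax hmem
      simp only [Set.mem_ofPred_eq] at this
      rw [habs, edgePoly_smul hF, hcA, inv_mul_le_iff₀ hA0] at this
      rw [hL, mul_assoc, mul_comm _ A]
      exact mul_le_mul_of_nonneg_left this (by positivity)
  have hL0 : 0 ≤ L := mul_nonneg (by positivity)
    (Finset.sum_nonneg fun _ _ => Finset.prod_nonneg fun v _ => hx0 v)
  -- `hbound` is an equality at `x`; varying one coordinate at a time replaces Lagrange multipliers.
  have hcrit : ∀ i, edgePolyPartial F i x = L * x i ^ d := by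
    intro i
    refine eq_mul_pow_of_forall_le hd (edgePolyPartial_nonneg F hx0 i) (hx0 i) fun c hc => ?_
    have h1 := hbound (Function.update x i c) (fun v => by
      by_cases hv : v = i
      · subst hv; simpa using hc
      · simpa [hv] using hx0 v)
    rw [edgePoly_update, mul_add, ← hL] at h1
    have h2 : ∑ v, Function.update x i c v ^ (d + 1) = 1 + (c ^ (d + 1) - x i ^ (d + 1)) := by
      rw [← hx1, ← Finset.add_sum_erase _ _ (mem_univ i),
        ← Finset.add_sum_erase _ (fun v => x v ^ (d + 1)) (mem_univ i),
        Finset.sum_congr rfl (g := fun v => x v ^ (d + 1))]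
      · simp only [Function.update_self]
        ring
      · intro v hv
        rw [Function.update_of_ne (ne_of_mem_erase hv)]
    rw [h2] at h1
    linarith
  have hxne : x ≠ 0 := by
    intro h
    simp [h] at hx1
  have heig : IsTensorEigenvalue a (L : ℂ) := ha.isTensorEigenvalue hF hxne hcrit
  have hle : L ≤ tensorSpectralRadius a := by
    have := le_csSup (bddAbove_norm_tensorEigenvalue a) ⟨L, heig, rfl⟩
    rwa [Complex.norm_real, Real.norm_of_nonneg hL0] at this
  exact (hbound z hz).trans (mul_le_mul_of_nonneg_right hle
    (Finset.sum_nonneg fun v _ => pow_nonneg (hz v) _))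

end EdgePoly

/-! ### Inequalities for forms in tail and head variables -/

/-- The form `∑ e, (∏ u ∈ T e, x u) * ∏ v ∈ H e, y v` of a finite family of pairs of sets. -/
def pairForm {ι A B : Type*} (E : Finset ι) (T : ι → Finset A) (H : ι → Finset B)
    (x : A → ℝ) (y : B → ℝ) : ℝ :=
  ∑ e ∈ E, (∏ u ∈ T e, x u) * ∏ v ∈ H e, y v

section PairForm

variable {ι A B : Type*} {E : Finset ι} {T : ι → Finset A} {H : ι → Finset B}

theorem pairForm_comm (x : A → ℝ) (y : B → ℝ) : pairForm E T H x y = pairForm E H T y x :=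
  Finset.sum_congr rfl fun _ _ => mul_comm _ _

theorem pairForm_nonneg {x : A → ℝ} {y : B → ℝ} (hx : ∀ u, 0 ≤ x u) (hy : ∀ v, 0 ≤ y v) :
    0 ≤ pairForm E T H x y :=
  Finset.sum_nonneg fun _ _ => mul_nonneg (Finset.prod_nonneg fun u _ => hx u)
    (Finset.prod_nonneg fun v _ => hy v)

theorem pairForm_le_abs (x : A → ℝ) (y : B → ℝ) :
    pairForm E T H x y ≤ pairForm E T H (fun u => |x u|) fun v => |y v| := by
  refine Finset.sum_le_sum fun e _ => ?_
  rw [← Finset.abs_prod, ← Finset.abs_prod, ← abs_mul]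
  exact le_abs_self _

theorem pairForm_smul {r s : ℕ} (hT : ∀ e ∈ E, (T e).card = r) (hH : ∀ e ∈ E, (H e).card = s)
    (a b : ℝ) (x : A → ℝ) (y : B → ℝ) :
    pairForm E T H (fun u => a * x u) (fun v => b * y v) = a ^ r * b ^ s * pairForm E T H x y := by
  unfold pairForm
  rw [Finset.mul_sum]
  refine Finset.sum_congr rfl fun e he => ?_
  rw [Finset.prod_mul_distrib, Finset.prod_const, Finset.prod_mul_distrib, Finset.prod_const,
    hT e he, hH e he]
  ring

theorem pairForm_eq_zero_of_left {r : ℕ} (hr : 1 ≤ r) (hT : ∀ e ∈ E, (T e).card = r)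
    {x : A → ℝ} (hx : ∀ u, x u = 0) (y : B → ℝ) : pairForm E T H x y = 0 := by
  refine Finset.sum_eq_zero fun e he => ?_
  obtain ⟨u, hu⟩ := Finset.card_pos.1 (by rw [hT e he]; omega : 0 < (T e).card)
  rw [Finset.prod_eq_zero hu (hx u), zero_mul]

variable [Fintype A] [Fintype B]

/-- A bound in terms of the sum of the `k`-th powers of the norms, `k = r + s`, yields one in
terms of their weighted geometric mean. -/
theorem mul_pairForm_le_of_sum_le {r s : ℕ} (hr : 1 ≤ r) (hs : 1 ≤ s)
    (hT : ∀ e ∈ E, (T e).card = r) (hH : ∀ e ∈ E, (H e).card = s) {R : ℝ} (hR0 : 0 ≤ R)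
    (hR : ∀ (z : A → ℝ) (w : B → ℝ), (∀ u, 0 ≤ z u) → (∀ v, 0 ≤ w v) →
      ((r + s : ℕ) : ℝ) * pairForm E T H z w ≤ R * (∑ u, z u ^ (r + s) + ∑ v, w v ^ (r + s)))
    {z : A → ℝ} {w : B → ℝ} (hz : ∀ u, 0 ≤ z u) (hw : ∀ v, 0 ≤ w v) {α β : ℝ} (hα : 0 < α)
    (hβ : 0 < β) (hzα : ∑ u, z u ^ (r + s) ≤ α) (hwβ : ∑ v, w v ^ (r + s) ≤ β) :
    (r : ℝ) ^ ((r : ℝ) / (r + s)) * (s : ℝ) ^ ((s : ℝ) / (r + s)) * pairForm E T H z w ≤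
      R * (α ^ ((r : ℝ) / (r + s)) * β ^ ((s : ℝ) / (r + s))) := by
  have hr0 : (0 : ℝ) < r := by exact_mod_cast hr
  have hs0 : (0 : ℝ) < s := by exact_mod_cast hs
  have hk0 : (0 : ℝ) < (r : ℝ) + s := by positivity
  set k : ℝ := (r : ℝ) + s with hk
  -- Scaling factors with a^k = r/(kα) and b^k = s/(kβ) make the sum of the two k-th power sums at
  -- most r/k + s/k = 1.
  have hscale : ∀ t γ : ℝ, 0 < t → 0 < γ → ∃ c, 0 < c ∧ c ^ (r + s) = t / (k * γ) ∧
      ∀ n : ℕ, c ^ n = (t / (k * γ)) ^ ((n : ℝ) / k) := by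
    intro t γ ht hγ
    have hb : 0 < t / (k * γ) := by positivity
    have hpow : ∀ n : ℕ, ((t / (k * γ)) ^ (1 / k)) ^ n = (t / (k * γ)) ^ ((n : ℝ) / k) := by
      intro n
      rw [← Real.rpow_natCast, ← Real.rpow_mul hb.le]
      congr 1
      ring
    refine ⟨(t / (k * γ)) ^ (1 / k), Real.rpow_pos_of_pos hb _, ?_, hpow⟩
    rw [hpow]
    push_cast
    rw [← hk, div_self hk0.ne', Real.rpow_one]
  obtain ⟨a, ha0, hak, ha⟩ := hscale r α hr0 hα
  obtain ⟨b, hb0, hbk, hb⟩ := hscale s β hs0 hβ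
  have h1 := hR (fun u => a * z u) (fun v => b * w v) (fun u => mul_nonneg ha0.le (hz u))
    fun v => mul_nonneg hb0.le (hw v)
  rw [pairForm_smul hT hH] at h1
  simp_rw [mul_pow] at h1
  rw [← Finset.mul_sum, ← Finset.mul_sum, hak, hbk, ha, hb] at h1
  have h2 : (r : ℝ) / (k * α) * ∑ u, z u ^ (r + s) + (s : ℝ) / (k * β) * ∑ v, w v ^ (r + s) ≤ 1 := by
    calc _ ≤ (r : ℝ) / (k * α) * α + (s : ℝ) / (k * β) * β := by gcongr
      _ = 1 := by
        field_simp
        exact hk.symm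
  have h3 := h1.trans (mul_le_mul_of_nonneg_left h2 hR0)
  have hkk : k ^ ((r : ℝ) / k) * k ^ ((s : ℝ) / k) = k := by
    rw [← Real.rpow_add hk0, ← add_div, ← hk, div_self hk0.ne', Real.rpow_one]
  rw [Real.div_rpow hr0.le (by positivity), Real.div_rpow hs0.le (by positivity),
    Real.mul_rpow hk0.le hα.le, Real.mul_rpow hk0.le hβ.le] at h3
  have hα' : 0 < α ^ ((r : ℝ) / k) := Real.rpow_pos_of_pos hα _
  have hβ' : 0 < β ^ ((s : ℝ) / k) := Real.rpow_pos_of_pos hβ _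
  have hk1 : 0 < k ^ ((r : ℝ) / k) := Real.rpow_pos_of_pos hk0 _
  have hk2 : 0 < k ^ ((s : ℝ) / k) := Real.rpow_pos_of_pos hk0 _
  generalize α ^ ((r : ℝ) / k) = α' at *
  generalize β ^ ((s : ℝ) / k) = β' at *
  generalize k ^ ((r : ℝ) / k) = k1 at *
  generalize k ^ ((s : ℝ) / k) = k2 at *
  generalize (r : ℝ) ^ ((r : ℝ) / k) = r' at *
  generalize (s : ℝ) ^ ((s : ℝ) / k) = s' at *
  push_cast at h3
  rw [← hk, ← hkk] at h3
  have h4 : k1 * k2 * (r' / (k1 * α') * (s' / (k2 * β')) * pairForm E T H z w) =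
      r' * s' * pairForm E T H z w / (α' * β') := by
    field_simp
  rw [h4, mul_one, div_le_iff₀ (by positivity)] at h3
  exact h3

/-- The upper bound for the form on the unit spheres of the `p`- and `q`-norm, `p ≤ q`. -/
theorem pairForm_le_rpow {r s : ℕ} (hr : 1 ≤ r) (hs : 1 ≤ s)
    (hT : ∀ e ∈ E, (T e).card = r) (hH : ∀ e ∈ E, (H e).card = s) {R : ℝ} (hR0 : 0 ≤ R)
    (hR : ∀ (z : A → ℝ) (w : B → ℝ), (∀ u, 0 ≤ z u) → (∀ v, 0 ≤ w v) →
      ((r + s : ℕ) : ℝ) * pairForm E T H z w ≤ R * (∑ u, z u ^ (r + s) + ∑ v, w v ^ (r + s)))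
    {p q : ℝ} (hp : 0 < p) (hpq' : p ≤ q) (hpq : (r : ℝ) / p + (s : ℝ) / q = 1)
    {x : A → ℝ} {y : B → ℝ} (hx : ∀ u, 0 ≤ x u) (hy : ∀ v, 0 ≤ y v)
    (hx1 : ∑ u, x u ^ p = 1) (hy1 : ∑ v, y v ^ q = 1) :
    pairForm E T H x y ≤
      1 / ((r : ℝ) ^ ((r : ℝ) / p) * (s : ℝ) ^ ((s : ℝ) / q)) * R ^ (((r : ℝ) + s) / p) := by
  classical
  have hq : 0 < q := hp.trans_le hpq'
  have hr0 : (0 : ℝ) < r := by exact_mod_cast hr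
  have hs0 : (0 : ℝ) < s := by exact_mod_cast hs
  have hk0 : (0 : ℝ) < (r : ℝ) + s := by positivity
  rcases (pairForm_nonneg (E := E) (T := T) (H := H) hx hy).eq_or_lt with hS | hS
  · rw [← hS]
    positivity
  set S := pairForm E T H x y with hSdef
  set k : ℝ := (r : ℝ) + s with hk
  set θ : ℝ := p / q with hθ
  have hθ0 : 0 < θ := by positivity
  have hθ1 : θ ≤ 1 := (div_le_one hq).2 hpq'
  have hps : (r : ℝ) + s * θ = p := by
    rw [hθ]
    field_simp at hpq ⊢
    linarith
  have hpk : p / k + s * ((1 - θ) / k) = 1 := by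
    rw [← hps, hk]
    field_simp
    ring
  -- the weights of the arcs and the weighted degrees
  set π : ι → ℝ := fun e => (∏ u ∈ T e, x u) * ∏ v ∈ H e, y v with hπ
  have hπ0 : ∀ e, 0 ≤ π e := fun e => mul_nonneg (Finset.prod_nonneg fun u _ => hx u)
    (Finset.prod_nonneg fun v _ => hy v)
  set D : B → ℝ := fun v => ∑ e ∈ E with v ∈ H e, π e with hD
  have hD0 : ∀ v, 0 ≤ D v := fun v => Finset.sum_nonneg fun e _ => hπ0 e
  have hDsum : ∑ v, D v = s * S := by
    simp only [hD, Finset.sum_filter]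
    rw [Finset.sum_comm, hSdef, pairForm, Finset.mul_sum]
    refine Finset.sum_congr rfl fun e he => ?_
    rw [← Finset.sum_filter, Finset.filter_mem_eq_inter, univ_inter, Finset.sum_const, hH e he,
      nsmul_eq_mul]
  have hsS : 0 < s * S := by positivity
  -- The power of `D` compensates for y^p having the wrong exponent: only y^q has sum 1.
  set z : A → ℝ := fun u => x u ^ (p / k) with hz
  set w : B → ℝ := fun v => y v ^ (p / k) * D v ^ ((1 - θ) / k) with hw
  have hz0 : ∀ u, 0 ≤ z u := fun u => Real.rpow_nonneg (hx u) _
  have hw0 : ∀ v, 0 ≤ w v := fun v =>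
    mul_nonneg (Real.rpow_nonneg (hy v) _) (Real.rpow_nonneg (hD0 v) _)
  have hpow : ∀ t c : ℝ, 0 ≤ t → (t ^ (c / k)) ^ (r + s) = t ^ c := by
    intro t c ht
    rw [← Real.rpow_natCast, ← Real.rpow_mul ht]
    push_cast
    rw [← hk, div_mul_cancel₀ _ hk0.ne']
  have hzsum : ∑ u, z u ^ (r + s) ≤ 1 := by
    rw [← hx1]
    exact (Finset.sum_congr rfl fun u _ => hpow _ _ (hx u)).le
  -- Hölder with weights θ and 1 - θ, proved termwise by AM-GM for y^q and D/(sS), both of total 1.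
  have hwsum : ∑ v, w v ^ (r + s) ≤ (s * S) ^ (1 - θ) := by
    have hB : 0 < (s * S) ^ (1 - θ) := Real.rpow_pos_of_pos hsS _
    have hterm : ∀ v, w v ^ (r + s) ≤
        (s * S) ^ (1 - θ) * (θ * y v ^ q + (1 - θ) * (D v / (s * S))) := by
      intro v
      have h1 := Real.geom_mean_le_arith_mean2_weighted hθ0.le (sub_nonneg.2 hθ1)
        (Real.rpow_nonneg (hy v) q) (div_nonneg (hD0 v) hsS.le) (by ring)
      have h2 : w v ^ (r + s) =
          (s * S) ^ (1 - θ) * ((y v ^ q) ^ θ * (D v / (s * S)) ^ (1 - θ)) := by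
        rw [hw]
        simp only
        rw [mul_pow, hpow _ _ (hy v), hpow _ _ (hD0 v), ← Real.rpow_mul (hy v), hθ,
          mul_div_cancel₀ _ hq.ne', ← hθ, Real.div_rpow (hD0 v) hsS.le]
        field_simp
      rw [h2]
      exact mul_le_mul_of_nonneg_left h1 hB.le
    refine (Finset.sum_le_sum fun v _ => hterm v).trans (le_of_eq ?_)
    rw [← Finset.mul_sum, Finset.sum_add_distrib, ← Finset.mul_sum, ← Finset.mul_sum, hy1,
      ← Finset.sum_div, hDsum, div_self hsS.ne']
    ring
  -- Arc by arc: each D_v with v ∈ H(e) is at least π(e), and by `hpk` the exponents of π(e) add up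
  -- to 1.
  have hlow : S ≤ pairForm E T H z w := by
    refine Finset.sum_le_sum fun e he => ?_
    show π e ≤ _
    have h1 : π e ^ ((s : ℝ) * ((1 - θ) / k)) ≤ ∏ v ∈ H e, D v ^ ((1 - θ) / k) := by
      rw [mul_comm, Real.rpow_mul (hπ0 e), Real.rpow_natCast, ← hH e he]
      rw [← Finset.prod_const]
      refine Finset.prod_le_prod (fun _ _ => Real.rpow_nonneg (hπ0 e) _) fun v hv => ?_
      refine Real.rpow_le_rpow (hπ0 e) ?_ (div_nonneg (sub_nonneg.2 hθ1) hk0.le)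
      exact Finset.single_le_sum (f := π) (fun e _ => hπ0 e) (by simp [he, hv])
    have h2 : (∏ u ∈ T e, z u) * ∏ v ∈ H e, w v =
        π e ^ (p / k) * ∏ v ∈ H e, D v ^ ((1 - θ) / k) := by
      rw [hz, hw]
      simp only
      rw [Finset.prod_mul_distrib, Real.finsetProd_rpow _ _ (fun u _ => hx u),
        Real.finsetProd_rpow _ _ (fun u _ => hy u), ← mul_assoc,
        ← Real.mul_rpow (Finset.prod_nonneg fun u _ => hx u)
        (Finset.prod_nonneg fun u _ => hy u)]
    rw [h2]
    rcases (hπ0 e).eq_or_lt with h0 | h0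
    · rw [← h0]
      exact mul_nonneg (Real.rpow_nonneg le_rfl _)
        (Finset.prod_nonneg fun v _ => Real.rpow_nonneg (hD0 v) _)
    · calc π e = π e ^ (p / k) * π e ^ ((s : ℝ) * ((1 - θ) / k)) := by
            rw [← Real.rpow_add h0, hpk, Real.rpow_one]
        _ ≤ _ := mul_le_mul_of_nonneg_left h1 (Real.rpow_nonneg h0.le _)
  have hmain := mul_pairForm_le_of_sum_le hr hs hT hH hR0 hR hz0 hw0 one_pos
    (Real.rpow_pos_of_pos hsS (1 - θ)) hzsum hwsum
  rw [← hk, Real.one_rpow, one_mul, ← Real.rpow_mul hsS.le] at hmain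
  have hc1 : 0 < (r : ℝ) ^ ((r : ℝ) / k) := Real.rpow_pos_of_pos hr0 _
  have hc2 : 0 < (s : ℝ) ^ ((s : ℝ) / k) := Real.rpow_pos_of_pos hs0 _
  have hmain2 := (mul_le_mul_of_nonneg_left hlow (mul_pos hc1 hc2).le).trans hmain
  -- Cancel the power of sS common to both sides; raising to the power k/p then isolates S.
  have hX : (r : ℝ) ^ ((r : ℝ) / k) * (s : ℝ) ^ ((s : ℝ) * θ / k) * S ^ (p / k) ≤ R := by
    have hpos : 0 < (s * S) ^ ((1 - θ) * (s / k)) := Real.rpow_pos_of_pos hsS _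
    refine le_of_mul_le_mul_right (le_trans (le_of_eq ?_) hmain2) hpos
    rw [Real.mul_rpow hs0.le hS.le]
    have e1 : (s : ℝ) ^ ((s : ℝ) * θ / k) * (s : ℝ) ^ ((1 - θ) * (s / k)) =
        (s : ℝ) ^ ((s : ℝ) / k) := by
      rw [← Real.rpow_add hs0]
      congr 1
      ring
    have e2 : S ^ (p / k) * S ^ ((1 - θ) * (s / k)) = S := by
      rw [← Real.rpow_add hS]
      conv_rhs => rw [← Real.rpow_one S]
      congr 1
      linear_combination hpk
    calc _ = (r : ℝ) ^ ((r : ℝ) / k) *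
          ((s : ℝ) ^ ((s : ℝ) * θ / k) * (s : ℝ) ^ ((1 - θ) * (s / k))) *
          (S ^ (p / k) * S ^ ((1 - θ) * (s / k))) := by ring
      _ = _ := by rw [e1, e2]
  have hY := Real.rpow_le_rpow (by positivity) hX (by positivity : 0 ≤ k / p)
  rw [Real.mul_rpow (by positivity) (by positivity), Real.mul_rpow (by positivity) (by positivity),
    ← Real.rpow_mul hr0.le, ← Real.rpow_mul hs0.le, ← Real.rpow_mul hS.le] at hY
  have e1 : (r : ℝ) / k * (k / p) = r / p := by field_simp
  have e2 : (s : ℝ) * θ / k * (k / p) = s / q := by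
    rw [hθ]
    field_simp
  have e3 : p / k * (k / p) = 1 := by field_simp
  rw [e1, e2, e3, Real.rpow_one] at hY
  rw [one_div, ← div_eq_inv_mul, le_div_iff₀ (by positivity), mul_comm]
  exact hY

/-- A bound on the product of the unit spheres of the `(r + s)`-norm, homogenized by the weighted
inequality of the arithmetic and the geometric mean. -/
theorem mul_pairForm_le_of_unit {r s : ℕ} (hr : 1 ≤ r) (hs : 1 ≤ s)
    (hT : ∀ e ∈ E, (T e).card = r) (hH : ∀ e ∈ E, (H e).card = s) {L : ℝ} (hL0 : 0 ≤ L)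
    (hL : ∀ (x : A → ℝ) (y : B → ℝ), (∀ u, 0 ≤ x u) → (∀ v, 0 ≤ y v) →
      ∑ u, x u ^ (r + s) = 1 → ∑ v, y v ^ (r + s) = 1 → pairForm E T H x y ≤ L)
    {z : A → ℝ} {w : B → ℝ} (hz : ∀ u, 0 ≤ z u) (hw : ∀ v, 0 ≤ w v) :
    ((r + s : ℕ) : ℝ) * pairForm E T H z w ≤
      ((r : ℝ) ^ r * (s : ℝ) ^ s) ^ (1 / ((r : ℝ) + s)) * L *
        (∑ u, z u ^ (r + s) + ∑ v, w v ^ (r + s)) := by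
  have hr0 : (0 : ℝ) < r := by exact_mod_cast hr
  have hs0 : (0 : ℝ) < s := by exact_mod_cast hs
  have hk0 : (0 : ℝ) < (r : ℝ) + s := by positivity
  have hα0 : 0 ≤ ∑ u, z u ^ (r + s) := Finset.sum_nonneg fun u _ => pow_nonneg (hz u) _
  have hβ0 : 0 ≤ ∑ v, w v ^ (r + s) := Finset.sum_nonneg fun v _ => pow_nonneg (hw v) _
  have hrhs : 0 ≤ ((r : ℝ) ^ r * (s : ℝ) ^ s) ^ (1 / ((r : ℝ) + s)) * L *
        (∑ u, z u ^ (r + s) + ∑ v, w v ^ (r + s)) := by positivity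
  -- A zero vector cannot be normalized, but then the form vanishes.
  rcases hα0.eq_or_lt with hα | hα
  · rw [pairForm_eq_zero_of_left hr hT (eq_zero_of_sum_pow_eq_zero hz hα.symm), mul_zero]
    exact hrhs
  rcases hβ0.eq_or_lt with hβ | hβ
  · rw [pairForm_comm, pairForm_eq_zero_of_left hs hH (eq_zero_of_sum_pow_eq_zero hw hβ.symm), mul_zero]
    exact hrhs
  set k : ℝ := (r : ℝ) + s with hk
  set α := ∑ u, z u ^ (r + s) with hαdef
  set β := ∑ v, w v ^ (r + s) with hβdef
  have hscale : ∀ γ : ℝ, 0 < γ → ∀ n : ℕ, (γ ^ (-(1 / k))) ^ n = (γ ^ ((n : ℝ) / k))⁻¹ := by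
    intro γ hγ n
    rw [← Real.rpow_natCast, ← Real.rpow_mul hγ.le, ← Real.rpow_neg hγ.le]
    congr 1
    ring
  have hscale' : ∀ γ : ℝ, 0 < γ → (γ ^ (-(1 / k))) ^ (r + s) = γ⁻¹ := by
    intro γ hγ
    rw [hscale γ hγ]
    push_cast
    rw [← hk, div_self hk0.ne', Real.rpow_one]
  have h1 := hL (fun u => α ^ (-(1 / k)) * z u) (fun v => β ^ (-(1 / k)) * w v)
    (fun u => mul_nonneg (Real.rpow_nonneg hα.le _) (hz u))
    (fun v => mul_nonneg (Real.rpow_nonneg hβ.le _) (hw v))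
    (by simp_rw [mul_pow]
        rw [← Finset.mul_sum, hscale' α hα, ← hαdef, inv_mul_cancel₀ hα.ne'])
    (by simp_rw [mul_pow]
        rw [← Finset.mul_sum, hscale' β hβ, ← hβdef, inv_mul_cancel₀ hβ.ne'])
  rw [pairForm_smul hT hH, hscale α hα, hscale β hβ, ← mul_inv,
    inv_mul_le_iff₀ (mul_pos (Real.rpow_pos_of_pos hα _) (Real.rpow_pos_of_pos hβ _))] at h1
  -- Dividing by r and s makes the weighted arithmetic mean equal to (α + β)/k, which absorbs the
  -- factor k.
  have h2 := Real.geom_mean_le_arith_mean2_weighted (w₁ := r / k) (w₂ := s / k)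
    (p₁ := α / r) (p₂ := β / s) (by positivity) (by positivity) (by positivity) (by positivity)
    (by rw [← add_div, ← hk, div_self hk0.ne'])
  have h3 : (r : ℝ) / k * (α / r) + s / k * (β / s) = (α + β) / k := by
    field_simp
  have h4 : ((r : ℝ) ^ r * (s : ℝ) ^ s) ^ (1 / k) =
      (r : ℝ) ^ ((r : ℝ) / k) * (s : ℝ) ^ ((s : ℝ) / k) := by
    rw [Real.mul_rpow (by positivity) (by positivity), ← Real.rpow_natCast_mul hr0.le,
      ← Real.rpow_natCast_mul hs0.le, mul_one_div, mul_one_div]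
  rw [h3, Real.div_rpow hα.le hr0.le, Real.div_rpow hβ.le hs0.le, div_mul_div_comm,
    ← h4, div_le_iff₀ (by positivity)] at h2
  calc ((r + s : ℕ) : ℝ) * pairForm E T H z w
      ≤ k * (α ^ ((r : ℝ) / k) * β ^ ((s : ℝ) / k) * L) := by
        push_cast
        exact mul_le_mul_of_nonneg_left h1 hk0.le
    _ ≤ k * ((α + β) / k * ((r : ℝ) ^ r * (s : ℝ) ^ s) ^ (1 / k) * L) := by gcongr
    _ = _ := by
        field_simp

end PairForm

/-! ### The bipartite split and its spectral quantities -/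

namespace DirectedHypergraph

variable {V : Type*} [DecidableEq V] (G : DirectedHypergraph V)

/-- The tail of an arc as a set of elements of `T(G)`. -/
def tailSet (e : Finset V × Finset V) : Finset G.tailVerts := e.1.subtype (· ∈ G.tailVerts)

/-- The head of an arc as a set of elements of `H(G)`. -/
def headSet (e : Finset V × Finset V) : Finset G.headVerts := e.2.subtype (· ∈ G.headVerts)

variable {G}

theorem map_tailSet {e : Finset V × Finset V} (he : e ∈ G.arcs) :
    (G.tailSet e).map (Function.Embedding.subtype _) = e.1 :=
  Finset.subtype_map_of_mem fun _ hu => Finset.mem_biUnion.2 ⟨e, he, hu⟩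

theorem map_headSet {e : Finset V × Finset V} (he : e ∈ G.arcs) :
    (G.headSet e).map (Function.Embedding.subtype _) = e.2 :=
  Finset.subtype_map_of_mem fun _ hu => Finset.mem_biUnion.2 ⟨e, he, hu⟩

theorem IsUniform.card_tailSet {r s : ℕ} (hG : G.IsUniform r s) :
    ∀ e ∈ G.arcs, (G.tailSet e).card = r := fun e he => by
  rw [← (hG e he).1, ← Finset.card_map, map_tailSet he]

theorem IsUniform.card_headSet {r s : ℕ} (hG : G.IsUniform r s) :
    ∀ e ∈ G.arcs, (G.headSet e).card = s := fun e he => by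
  rw [← (hG e he).2, ← Finset.card_map, map_headSet he]

variable (G)

/-- The copy of a vertex of the bipartite split in the underlying hypergraph. -/
def splitVertex : G.tailVerts ⊕ G.headVerts ↪ G.bipartiteSplit.underlying.vertexSet :=
  ⟨fun v => ⟨v, Set.mem_univ v⟩, fun _ _ h => congrArg Subtype.val h⟩

/-- The edge of the underlying hypergraph of the bipartite split given by an arc. -/
def splitEdge (e : Finset V × Finset V) : Finset G.bipartiteSplit.underlying.vertexSet :=
  ((G.tailSet e).disjSum (G.headSet e)).map G.splitVertex

open Classical in
/-- The edges of the underlying hypergraph of the bipartite split. -/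
def splitEdges : Finset (Finset G.bipartiteSplit.underlying.vertexSet) :=
  G.arcs.image G.splitEdge

variable {G}

/-- Tail and head are recovered as the left and right parts of the edge, so distinct arcs never
merge in the underlying hypergraph. -/
theorem splitEdge_injOn : Set.InjOn G.splitEdge G.arcs := by
  intro e he f hf h
  have h1 := congrArg Finset.toLeft (Finset.map_injective _ h)
  have h2 := congrArg Finset.toRight (Finset.map_injective _ h)
  simp only [Finset.toLeft_disjSum, Finset.toRight_disjSum] at h1 h2
  refine Prod.ext ?_ ?_
  · rw [← map_tailSet he, h1, map_tailSet hf]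
  · rw [← map_headSet he, h2, map_headSet hf]

theorem edgePoly_splitEdges (z : G.bipartiteSplit.underlying.vertexSet → ℝ) :
    edgePoly G.splitEdges z = pairForm G.arcs G.tailSet G.headSet
      (fun u => z (G.splitVertex (.inl u))) (fun v => z (G.splitVertex (.inr v))) := by
  unfold edgePoly splitEdges pairForm
  rw [Finset.sum_image splitEdge_injOn]
  refine Finset.sum_congr rfl fun e _ => ?_
  rw [splitEdge, Finset.prod_map, Finset.prod_disjSum]

theorem sum_splitVertex (f : G.bipartiteSplit.underlying.vertexSet → ℝ) :
    ∑ v, f v = ∑ u, f (G.splitVertex (.inl u)) + ∑ v, f (G.splitVertex (.inr v)) := by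
  rw [← Fintype.sum_sum_type (fun v => f (G.splitVertex v))]
  refine (Fintype.sum_bijective G.splitVertex ⟨G.splitVertex.injective, fun v => ⟨v.1, rfl⟩⟩ _ _
    fun _ => rfl).symm

theorem IsUniform.card_splitEdges {r s : ℕ} (hr : 1 ≤ r) (hG : G.IsUniform r s) :
    ∀ e ∈ G.splitEdges, e.card = r + s - 1 + 1 := by
  intro e he
  obtain ⟨f, hf, rfl⟩ := Finset.mem_image.1 he
  rw [splitEdge, Finset.card_map, Finset.card_disjSum, hG.card_tailSet f hf, hG.card_headSet f hf]
  omega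

theorem coe_splitEdge (e : Finset V × Finset V) :
    Subtype.val '' (G.splitEdge e : Set G.bipartiteSplit.underlying.vertexSet) =
      (((G.tailSet e).map Function.Embedding.inl : Finset (G.tailVerts ⊕ G.headVerts)) : Set _) ∪
        (((G.headSet e).map Function.Embedding.inr : Finset (G.tailVerts ⊕ G.headVerts)) :
          Set _) := by
  ext v
  rw [splitEdge, Finset.coe_map, ← Set.image_comp]
  have : Subtype.val ∘ G.splitVertex = id := rfl
  rw [this, Set.image_id]
  rcases v with v | v <;> simp

open Classical in
theorem isEdgeTensor_splitEdges (k : ℕ) :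
    IsEdgeTensor (G.bipartiteSplit.underlying.adjacencyTensor k) G.splitEdges := by
  intro i
  have : Set.range (fun l => (i l : G.tailVerts ⊕ G.headVerts)) ∈
      G.bipartiteSplit.underlying.edgeSet ↔ univ.image i ∈ G.splitEdges := by
    have hrange : Set.range (fun l => (i l : G.tailVerts ⊕ G.headVerts)) =
        Subtype.val '' ((univ.image i : Finset G.bipartiteSplit.underlying.vertexSet) :
          Set G.bipartiteSplit.underlying.vertexSet) := by
      rw [Finset.coe_image, Finset.coe_univ, Set.image_univ, ← Set.range_comp]
      rfl
    rw [hrange]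
    constructor
    · rintro ⟨_, hf, h⟩
      obtain ⟨e, he, rfl⟩ := Finset.mem_image.1 hf
      refine Finset.mem_image.2 ⟨e, he, ?_⟩
      refine Finset.coe_injective (Set.image_injective.2 Subtype.val_injective ?_)
      rw [h, coe_splitEdge, Finset.coe_union]
      rfl
    · intro h
      obtain ⟨e, he, h⟩ := Finset.mem_image.1 h
      refine ⟨_, Finset.mem_image_of_mem _ he, ?_⟩
      rw [← h, coe_splitEdge, Finset.coe_union]
      rfl
  unfold Hypergraph.adjacencyTensor
  simp only [this]

theorem spectralRadius_split_nonneg (k : ℕ) :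
    0 ≤ G.bipartiteSplit.underlying.spectralRadius k := by
  refine Real.sSup_nonneg ?_
  rintro t ⟨μ, -, rfl⟩
  exact norm_nonneg μ

theorem IsUniform.mul_pairForm_le {r s : ℕ} (hr : 1 ≤ r) (hs : 1 ≤ s) (hG : G.IsUniform r s)
    (z : G.tailVerts → ℝ) (w : G.headVerts → ℝ) (hz : ∀ u, 0 ≤ z u) (hw : ∀ v, 0 ≤ w v) :
    ((r + s : ℕ) : ℝ) * pairForm G.arcs G.tailSet G.headSet z w ≤
      G.bipartiteSplit.underlying.spectralRadius (r + s) *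
        (∑ u, z u ^ (r + s) + ∑ v, w v ^ (r + s)) := by
  classical
  have hk : r + s - 1 + 1 = r + s := by omega
  have := (isEdgeTensor_splitEdges (G := G) (r + s)).mul_edgePoly_le (by omega)
    (hG.card_splitEdges hr) (z := fun v => Sum.elim z w v.1) (by
      rintro ⟨v | v, -⟩
      · exact hz v
      · exact hw v)
  rw [edgePoly_splitEdges, sum_splitVertex, hk] at this
  exact this

theorem IsUniform.spectralRadius_split_le {r s : ℕ} (hr : 1 ≤ r) (hG : G.IsUniform r s) {C : ℝ}
    (hC : 0 ≤ C) (h : ∀ (z : G.tailVerts → ℝ) (w : G.headVerts → ℝ), (∀ u, 0 ≤ z u) →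
      (∀ v, 0 ≤ w v) → ((r + s : ℕ) : ℝ) * pairForm G.arcs G.tailSet G.headSet z w ≤
        C * (∑ u, z u ^ (r + s) + ∑ v, w v ^ (r + s))) :
    G.bipartiteSplit.underlying.spectralRadius (r + s) ≤ C := by
  classical
  have hk : r + s - 1 + 1 = r + s := by omega
  refine (isEdgeTensor_splitEdges (G := G) (r + s)).spectralRadius_le (hG.card_splitEdges hr) hC
    fun z hz => ?_
  rw [edgePoly_splitEdges, sum_splitVertex, hk]
  exact h _ _ (fun u => hz _) fun v => hz _

/-- The `(p, q)`-spectral radius is bounded by any bound on the form at nonnegative vectors. -/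
theorem lambda_le {p q C : ℝ} (hp : 0 < p) (hq : 0 < q) (hC : 0 ≤ C)
    (h : ∀ (x : G.tailVerts → ℝ) (y : G.headVerts → ℝ), (∀ u, 0 ≤ x u) → (∀ v, 0 ≤ y v) →
      ∑ u, x u ^ p = 1 → ∑ v, y v ^ q = 1 → pairForm G.arcs G.tailSet G.headSet x y ≤ C) :
    G.lambda p q ≤ C := by
  refine Real.sSup_le ?_ hC
  rintro t ⟨x, y, hx, hy, rfl⟩
  exact (pairForm_le_abs x y).trans (h _ _ (fun _ => abs_nonneg _) (fun _ => abs_nonneg _)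
    ((vecNorm_eq_one_iff hp).1 hx) ((vecNorm_eq_one_iff hq).1 hy))

theorem IsUniform.pairForm_le_lambda {r s : ℕ} (hr : 1 ≤ r) (hs : 1 ≤ s) (hG : G.IsUniform r s)
    {p q : ℝ} (hp : 1 ≤ p) (hq : 1 ≤ q) {x : G.tailVerts → ℝ} {y : G.headVerts → ℝ}
    (hx0 : ∀ u, 0 ≤ x u) (hy0 : ∀ v, 0 ≤ y v) (hx : ∑ u, x u ^ p = 1) (hy : ∑ v, y v ^ q = 1) :
    pairForm G.arcs G.tailSet G.headSet x y ≤ G.lambda p q := by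
  have hmem : pairForm G.arcs G.tailSet G.headSet x y ∈ G.formValues p q := by
    refine ⟨x, y, (vecNorm_eq_one_iff (by linarith)).2 ?_,
      (vecNorm_eq_one_iff (by linarith)).2 ?_, rfl⟩
    · simpa only [abs_of_nonneg (hx0 _)] using hx
    · simpa only [abs_of_nonneg (hy0 _)] using hy
  -- Without arcs all values of the form are 0, and the supremum is nonnegative even over the empty
  -- set.
  rcases G.arcs.eq_empty_or_nonempty with h | h
  · refine (show pairForm G.arcs G.tailSet G.headSet x y = 0 by simp [pairForm, h]).le.trans
      (Real.sSup_nonneg ?_)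
    rintro t ⟨x, y, -, -, rfl⟩
    simp [polyForm, h]
  · exact (G.isGreatest_lambda hr hs hG h hp hq).2 hmem

theorem lambda_nonneg {r s : ℕ} (hr : 1 ≤ r) (hs : 1 ≤ s) (hG : G.IsUniform r s)
    {p q : ℝ} (hp : 1 ≤ p) (hq : 1 ≤ q) : 0 ≤ G.lambda p q := by
  rcases (G.formValues p q).eq_empty_or_nonempty with h | ⟨t, x, y, hx, hy, -⟩
  · rw [lambda, h, Real.sSup_empty]
  · exact (pairForm_nonneg (fun _ => abs_nonneg _) fun _ => abs_nonneg _).trans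
      (hG.pairForm_le_lambda hr hs hp hq (fun u => abs_nonneg (x u)) (fun v => abs_nonneg (y v))
        ((vecNorm_eq_one_iff (by linarith)).1 hx) ((vecNorm_eq_one_iff (by linarith)).1 hy))

end DirectedHypergraph

end

/-! ### The three comparisons -/

theorem mainTheorem11 {V : Type*} [DecidableEq V] (G : DirectedHypergraph V) (r s : ℕ)
    (hr : 1 ≤ r) (hs : 1 ≤ s) (hG : G.IsUniform r s) (p q : ℝ) (hp : 1 ≤ p) (hq : 1 ≤ q)
    (hpq : (r : ℝ) / p + (s : ℝ) / q = 1) :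
    (p ≤ q → G.lambda p q ≤ 1 / ((r : ℝ) ^ ((r : ℝ) / p) * (s : ℝ) ^ ((s : ℝ) / q)) *
      (G.bipartiteSplit.underlying.spectralRadius (r + s)) ^ (((r : ℝ) + s) / p)) ∧
    (q < p → G.lambda p q ≤ 1 / ((r : ℝ) ^ ((r : ℝ) / p) * (s : ℝ) ^ ((s : ℝ) / q)) *
      (G.bipartiteSplit.underlying.spectralRadius (r + s)) ^ (((r : ℝ) + s) / q)) ∧
    (p = (r : ℝ) + s → q = (r : ℝ) + s →
      G.lambda p q = 1 / ((r : ℝ) ^ r * (s : ℝ) ^ s) ^ (1 / ((r : ℝ) + s)) *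
        G.bipartiteSplit.underlying.spectralRadius (r + s)) := by
  have hp0 : 0 < p := by linarith
  have hq0 : 0 < q := by linarith
  have hR0 := DirectedHypergraph.spectralRadius_split_nonneg (G := G) (r + s)
  have hR := hG.mul_pairForm_le hr hs
  have h1 : p ≤ q → G.lambda p q ≤ 1 / ((r : ℝ) ^ ((r : ℝ) / p) * (s : ℝ) ^ ((s : ℝ) / q)) *
      (G.bipartiteSplit.underlying.spectralRadius (r + s)) ^ (((r : ℝ) + s) / p) := by
    intro h
    refine DirectedHypergraph.lambda_le hp0 hq0 (by positivity) fun x y hx hy hx1 hy1 => ?_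
    exact pairForm_le_rpow hr hs hG.card_tailSet hG.card_headSet hR0 hR hp0 h hpq hx hy hx1 hy1
  refine ⟨h1, fun h => ?_, fun hpk hqk => ?_⟩
  · refine DirectedHypergraph.lambda_le hp0 hq0 (by positivity) fun x y hx hy hx1 hy1 => ?_
    -- Exchange tails and heads, hence r with s and p with q.
    rw [pairForm_comm, mul_comm ((r : ℝ) ^ _), add_comm (r : ℝ)]
    refine pairForm_le_rpow hs hr hG.card_headSet hG.card_tailSet hR0 (fun z w hz hw => ?_) hq0
      h.le (by linarith) hy hx hy1 hx1
    rw [pairForm_comm, add_comm s, add_comm (∑ u, z u ^ _)]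
    exact hR w z hw hz
  · have hr0 : (0 : ℝ) < r := by exact_mod_cast hr
    have hs0 : (0 : ℝ) < s := by exact_mod_cast hs
    have hc : (r : ℝ) ^ ((r : ℝ) / p) * (s : ℝ) ^ ((s : ℝ) / q) =
        ((r : ℝ) ^ r * (s : ℝ) ^ s) ^ (1 / ((r : ℝ) + s)) := by
      rw [Real.mul_rpow (by positivity) (by positivity), ← Real.rpow_natCast_mul hr0.le,
        ← Real.rpow_natCast_mul hs0.le, mul_one_div, mul_one_div, hpk, hqk]
    have hc0 : 0 < ((r : ℝ) ^ r * (s : ℝ) ^ s) ^ (1 / ((r : ℝ) + s)) := by positivity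
    refine le_antisymm ?_ ?_
    · have h := h1 (hpk.trans hqk.symm).le
      have he : ((r : ℝ) + s) / p = 1 := by rw [hpk, div_self (by positivity)]
      rwa [hc, he, Real.rpow_one] at h
    -- It remains to see that (r^r s^s)^{1/k} λ is an admissible constant in the inequality
    -- characterizing the spectral radius.
    · rw [one_div, ← div_eq_inv_mul, div_le_iff₀ hc0, mul_comm]
      have hL0 := DirectedHypergraph.lambda_nonneg hr hs hG hp hq
      refine hG.spectralRadius_split_le hr (by positivity) fun z w hz hw => ?_
      refine mul_pairForm_le_of_unit hr hs hG.card_tailSet hG.card_headSet hL0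
        (fun x y hx hy hx1 hy1 => ?_) hz hw
      refine hG.pairForm_le_lambda hr hs hp hq hx hy ?_ ?_
      · rw [hpk, ← hx1]
        exact Finset.sum_congr rfl fun u _ => by exact_mod_cast Real.rpow_natCast (x u) (r + s)
      · rw [hqk, ← hy1]
        exact Finset.sum_congr rfl fun u _ => by exact_mod_cast Real.rpow_natCast (y u) (r + s)
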